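/- Let $k$ be a field of arbitrary characteristic, let $X$ be a smooth, geometrically connected (in particular nonempty) $k$-scheme, and let $S$ be a locally Noetherian $k$-scheme. Let $\mathrm{Ran}(X)$ be the presheaf of sets on affine $k$-schemes which sends $T$ to the set of nonempty finite subsets of $\mathrm{Maps}_k(T,X)$, with restriction along $T'\to T$ given by taking images of subsets, and let $S\times\mathrm{Ran}(X)$ be the presheaf $T\mapsto \mathrm{Maps}_k(T,S)\times\mathrm{Ran}(X)(T)$. For a presheaf of sets $F$ on affine $k$-schemes, let $\Gamma(F,\mathcal O)=\lim_{T\to F}\Gamma(T,\mathcal O)$ be the ring of families $(a_{T,x})$, $a_{T,x}\in\Gamma(T,\mathcal O)$, indexed by the affine $k$-schemes $T$ and $x\in F(T)$, which are compatible with pullback along all morphisms $T'\to T$ over $k$. Then the pullback map $$\Gamma(S,\mathcal O)\longrightarrow\Gamma(S\times\mathrm{Ran}(X),\mathcal O)$$ along the projection $S\times\mathrm{Ran}(X)\to S$ is an isomorphism of rings. -/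

import Mathlib

open CategoryTheory Opposite AlgebraicGeometry

universe u

namespace RanSpace

noncomputable section

section

variable (k : Type u) [Field k]

/-- The category of affine schemes over the field `k` (of arbitrary size). -/
abbrev AffSch : Type (u + 1) :=
  ObjectProperty.FullSubcategory fun T : Over (Spec (.of k)) ↦ IsAffine T.left

/-- A (set-valued) prestack over `k`: a presheaf of sets on affine `k`-schemes. -/
abbrev Prestack : Type (u + 1) := (AffSch k)ᵒᵖ ⥤ Type u

end

variable {k : Type u} [Field k]

/-- The prestack of points of a `k`-scheme `Y`, `T ↦ Maps_k(T, Y)`. -/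
def points (Y : Over (Spec (.of k))) : Prestack k where
  obj T := T.unop.obj ⟶ Y
  map f := ↾fun y ↦ f.unop.hom ≫ y

/-- The Ran prestack of a `k`-scheme `X`: it sends an affine `k`-scheme `T` to the set of
nonempty finite subsets of `Maps_k(T, X)`, and a map `T' ⟶ T` to the operation of taking the
image of a subset under restriction along `T' ⟶ T`. -/
def Ran (X : Over (Spec (.of k))) : Prestack k where
  obj T := {A : Set (T.unop.obj ⟶ X) // A.Finite ∧ A.Nonempty}
  map f := ↾fun A ↦ ⟨(fun x ↦ f.unop.hom ≫ x) '' A.1, A.2.1.image _, A.2.2.image _⟩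
  map_id T := by
    ext A
    simp
  map_comp f g := by
    ext A
    simp [Set.image_image]

/-- The product of two prestacks over `k`, computed pointwise. -/
def prod (F G : Prestack k) : Prestack k where
  obj T := F.obj T × G.obj T
  map f := ↾fun x ↦ (F.map f x.1, G.map f x.2)

/-- The ring `Γ(F, 𝒪)` of regular functions on a prestack `F`, i.e. the limit of `Γ(T, 𝒪)` over
all affine `k`-schemes `T` equipped with a point `x ∈ F(T)`: an element is a family of functions
`a T x ∈ Γ(T, 𝒪)` that is compatible with restriction along all maps of affine `k`-schemes. -/
def functions (F : Prestack k) :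
    Subring (∀ T : AffSch k, F.obj (op T) → Γ(T.obj.left, ⊤)) where
  carrier := {a | ∀ (T T' : AffSch k) (f : T' ⟶ T) (x : F.obj (op T)),
    a T' (F.map f.op x) = f.hom.left.appTop (a T x)}
  mul_mem' ha hb T T' f x := by simp [ha T T' f x, hb T T' f x]
  one_mem' T T' f x := by simp
  add_mem' ha hb T T' f x := by simp [ha T T' f x, hb T T' f x]
  zero_mem' T T' f x := by simp
  neg_mem' ha T T' f x := by simp [ha T T' f x]

/-- The pullback map `Γ(S, 𝒪) → Γ(S × F, 𝒪)` along the projection `S × F → S`, for a `k`-scheme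
`S` and a prestack `F` over `k`: it sends `b` to the family whose value at a point
`(s, x) ∈ S(T) × F(T)` is the pullback of `b` along `s : T ⟶ S`. -/
def pullback (S : Over (Spec (.of k))) (F : Prestack k) :
    Γ(S.left, ⊤) →+* functions (prod (points S) F) where
  toFun b := ⟨fun _ x ↦ Over.Hom.left x.1 |>.appTop b, fun T T' f x ↦ by
    change (f.hom.left ≫ x.1.left).appTop b = _
    rw [Scheme.Hom.comp_appTop]
    rfl⟩
  map_one' := by ext; simp
  map_mul' _ _ := by ext; simp
  map_zero' := by ext; simp
  map_add' _ _ := by ext; simp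

end

end RanSpace

/-!
A function on `S × Ran(X)` assigns to an affine scheme `T`, a point `s ∈ S(T)` and a finite nonempty
`A ⊆ X(T)` an element `f(s, A) ∈ Γ(T, 𝒪)`, naturally in `T`. The point is that `f(s, A)` does not
depend on `A`. The argument works for an arbitrary prestack `F` in place of `S`. This generality is
used throughout, because adjoining a point `c` to all sets turns a function on `F × Ran(X)` into a
function on `(F × X) × Ran(X)` (`adjoin`).

*Near a rational point.* Let `x` be a rational point of an affine scheme `Spec A` mapping to `X`,
with ideal `m`. The differences `f(s, {y}) - f(s, {y, x})` and `f(s, {x}) - f(s, {y, x})` are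
functions of `y` in `A ⊗ R`. Since union of sets is idempotent, each is the restriction to the
diagonal `y = y₁` of a difference of the same shape, with parameters over `A ⊗ R`, which vanishes at
`y₁ = x`: in the first case replace `A ↦ f(s, A)` by `A ↦ f(s, A ∪ {y₁})`, in the second by
`A ↦ f(s, A) - f(s, A ∪ {y₁})`. By induction both differences lie in `mⁿ(A ⊗ R)` for all `n`
(`mem_map_pow_of_forall_exists_diagonal`). If `A` is Noetherian, Krull's intersection theorem gives
one neighbourhood of `x`, independent of `F`, `f` and `R`, on which `f(s, {y}) = f(s, {x})`
(`exists_value_single_eq`).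

*Globally.* Let the ground field be algebraically closed and `X` be connected and locally of finite
type. These neighbourhoods cover `X`, and two that meet share a rational point. So `f(s, {x})` is
the same for all rational points `x`, hence `f(s, {y})` is this value for all `y` by locality, and
adjoining points one at a time deals with larger sets (`value_eq_of_isAlgClosed`). For a
geometrically connected scheme over an arbitrary field, pass to the algebraic closure (`value_eq`).

*Descent.* Choose a point of `X` over a nonzero `k`-algebra `B`. Over `T ×ₖ Spec B` the common value
of `f` over `s` equalizes the two pullbacks to `T ×ₖ Spec B ×ₖ Spec B`, so it descends to `T`. Hence
`Γ(F, 𝒪) → Γ(F × Ran(X), 𝒪)` is bijective (`comap_fstRan_bijective`). Finally `Γ(S, 𝒪)` is the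
ring of functions on the prestack of points of `S`, by gluing over affine open subsets
(`evalPoints_bijective`).
-/

namespace RanSpace

noncomputable section

/-! ### Vanishing to infinite order along a rational point -/

section Algebra

open scoped TensorProduct
open Algebra.TensorProduct (includeLeft includeRight)

variable {K A : Type u} [Field K] [CommRing A] [Algebra K A]

/-- Evaluation at an augmentation `ε` in the first factor, `A ⊗ R → R`. -/
def evalLeft (ε : A →ₐ[K] K) (R : Type u) [CommRing R] [Algebra K R] : A ⊗[K] R →ₐ[K] R :=
  Algebra.TensorProduct.lift ((Algebra.ofId K R).comp ε) (AlgHom.id K R) fun _ _ ↦ .all _ _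

/-- Evaluation at an augmentation `ε` in the second of two copies of `A`,
`A ⊗ (A ⊗ R) → A ⊗ R`. -/
def evalSnd (ε : A →ₐ[K] K) (R : Type u) [CommRing R] [Algebra K R] :
    A ⊗[K] (A ⊗[K] R) →ₐ[K] A ⊗[K] R :=
  Algebra.TensorProduct.map (AlgHom.id K A) (evalLeft ε R)

/-- Restriction to the diagonal of the two copies of `A`, `A ⊗ (A ⊗ R) → A ⊗ R`. -/
def diagonal (A R : Type u) [CommRing A] [Algebra K A] [CommRing R] [Algebra K R] :
    A ⊗[K] (A ⊗[K] R) →ₐ[K] A ⊗[K] R :=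
  Algebra.TensorProduct.lift includeLeft (AlgHom.id K _) fun _ _ ↦ .all _ _

/-- The inclusion `A ⊗ R → A ⊗ (A ⊗ R)` that omits the second copy of `A`; it is a section of
both `evalSnd` and `diagonal`. -/
def omitSnd (A R : Type u) [CommRing A] [Algebra K A] [CommRing R] [Algebra K R] :
    A ⊗[K] R →ₐ[K] A ⊗[K] (A ⊗[K] R) :=
  Algebra.TensorProduct.map (AlgHom.id K A) includeRight

variable (R : Type u) [CommRing R] [Algebra K R]

@[simp]
lemma evalLeft_tmul (ε : A →ₐ[K] K) (a : A) (r : R) :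
    evalLeft ε R (a ⊗ₜ r) = algebraMap K R (ε a) * r := by
  simp [evalLeft, Algebra.ofId_apply]

@[simp]
lemma evalSnd_tmul (ε : A →ₐ[K] K) (a : A) (z : A ⊗[K] R) :
    evalSnd ε R (a ⊗ₜ z) = a ⊗ₜ evalLeft ε R z := by
  simp [evalSnd]

@[simp]
lemma diagonal_tmul (a : A) (z : A ⊗[K] R) :
    diagonal (K := K) A R (a ⊗ₜ z) = a ⊗ₜ 1 * z := by
  simp [diagonal]

@[simp]
lemma omitSnd_tmul (a : A) (r : R) : omitSnd (K := K) A R (a ⊗ₜ r) = a ⊗ₜ (1 ⊗ₜ r) := by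
  simp [omitSnd]

/-- On the diagonal, replacing the second point by `x` changes a function only by an element of the
ideal of `x`. -/
lemma diagonal_sub_mem (ε : A →ₐ[K] K) (d : A ⊗[K] (A ⊗[K] R)) :
    diagonal A R (d - omitSnd A R (evalSnd ε R d)) ∈
      (RingHom.ker ε).map (includeLeft : A →ₐ[K] A ⊗[K] R) := by
  induction d with
  | zero => simp
  | add x y hx hy =>
    rw [map_add, map_add, add_sub_add_comm, map_add]
    exact add_mem hx hy
  | tmul a z =>
    induction z with
    | zero => simp
    | add x y hx hy =>
      rw [TensorProduct.tmul_add, map_add, map_add, add_sub_add_comm, map_add]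
      exact add_mem hx hy
    | tmul b r =>
      have hb : b - algebraMap K A (ε b) ∈ RingHom.ker ε := by
        simp [RingHom.mem_ker]
      have := Ideal.mul_mem_left _ (a ⊗ₜ[K] r)
        (Ideal.mem_map_of_mem (includeLeft : A →ₐ[K] A ⊗[K] R) hb)
      convert! this using 1
      simp [mul_sub, TensorProduct.sub_tmul, Algebra.algebraMap_eq_smul_one,
        TensorProduct.smul_tmul']

/-- A function of two points `y`, `y₁` of `Spec A` that vanishes to order `n` along `y = x` and
vanishes for `y₁ = x` restricts to a function on the diagonal `y = y₁` that vanishes to order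
`n + 1` along `y = x`. -/
lemma diagonal_mem_map_pow_succ (ε : A →ₐ[K] K) (n : ℕ) {z : A ⊗[K] (A ⊗[K] R)}
    (hz : z ∈ (RingHom.ker ε ^ n).map (includeLeft : A →ₐ[K] A ⊗[K] (A ⊗[K] R)))
    (h0 : evalSnd ε R z = 0) :
    diagonal A R z ∈ (RingHom.ker ε ^ (n + 1)).map (includeLeft : A →ₐ[K] A ⊗[K] R) := by
  -- Subtracting `omitSnd (evalSnd z) = 0` from `z` turns each coefficient of an element of
  -- `ker ε ^ n` into one that lies in the ideal of `x` on the diagonal.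
  suffices h : ∀ c, diagonal A R (c * z - omitSnd A R (evalSnd ε R (c * z))) ∈
      (RingHom.ker ε ^ (n + 1)).map (includeLeft : A →ₐ[K] A ⊗[K] R) by
    simpa [h0] using h 1
  clear h0
  refine Submodule.span_induction ?_ (by simp) ?_ ?_ hz
  · rintro _ ⟨a, ha, rfl⟩ c
    have key : diagonal A R (c * includeLeft (R := K) (S := K) a -
        omitSnd A R (evalSnd ε R (c * includeLeft (R := K) (S := K) a))) =
        diagonal A R (c - omitSnd A R (evalSnd ε R c)) * includeLeft (R := K) (S := K) a := by
      simp [sub_mul, Algebra.TensorProduct.one_def]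
    erw [key]
    rw [pow_succ', Ideal.map_mul]
    exact Ideal.mul_mem_mul (diagonal_sub_mem R ε c) (Ideal.mem_map_of_mem _ ha)
  · intro x y _ _ hx hy c
    rw [mul_add, map_add, map_add, add_sub_add_comm, map_add]
    exact add_mem (hx c) (hy c)
  · intro c x _ hx d
    rw [smul_eq_mul, ← mul_assoc]
    exact hx _

/-- A class of functions `h ∈ A ⊗ R` (for varying `R`), each of which is the restriction to the
diagonal of a function in the class over `A ⊗ R` that vanishes when the additional point is `x`,
consists of functions vanishing to infinite order along `x`. -/
lemma mem_map_pow_of_forall_exists_diagonal (ε : A →ₐ[K] K)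
    (H : ∀ (R : Type u) [CommRing R] [Algebra K R], A ⊗[K] R → Prop)
    (step : ∀ (R : Type u) [CommRing R] [Algebra K R] (h : A ⊗[K] R), H R h →
      ∃ z, H (A ⊗[K] R) z ∧ evalSnd ε R z = 0 ∧ diagonal A R z = h)
    (n : ℕ) {h : A ⊗[K] R} (hh : H R h) :
    h ∈ (RingHom.ker ε ^ n).map (includeLeft : A →ₐ[K] A ⊗[K] R) := by
  induction n generalizing R with
  | zero => simp [Ideal.one_eq_top, Ideal.map_top]
  | succ n ih =>
    obtain ⟨z, hz, h0, rfl⟩ := step R h hh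
    exact diagonal_mem_map_pow_succ R ε n (ih _ hz) h0

/-- By Krull's intersection theorem, functions vanishing to infinite order along a rational point
vanish on a neighbourhood of that point, uniformly in the parameter ring `R`. -/
lemma exists_tmul_one_mul_eq_zero [IsNoetherianRing A] (ε : A →ₐ[K] K) :
    ∃ g : A, ε g = 1 ∧ ∀ (R : Type u) [CommRing R] [Algebra K R] (h : A ⊗[K] R),
      (∀ n, h ∈ (RingHom.ker ε ^ n).map (includeLeft : A →ₐ[K] A ⊗[K] R)) → g ⊗ₜ 1 * h = 0 := by
  classical
  set m := RingHom.ker ε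
  have hkill : ∃ g : A, ε g = 1 ∧ ∀ a, (∀ n, a ∈ m ^ n) → g * a = 0 := by
    obtain ⟨s, hs⟩ := (inferInstance : IsNoetherian A A).noetherian (⨅ n : ℕ, m ^ n • ⊤)
    have hmem : ∀ a ∈ s, ∃ r : m, (r : A) • a = a := fun a ha ↦
      (m.mem_iInf_smul_pow_eq_bot_iff a).mp (hs ▸ Submodule.subset_span ha)
    choose! r hr using hmem
    refine ⟨∏ a ∈ s, (1 - (r a : A)), ?_, fun a ha ↦ ?_⟩
    · rw [map_prod]
      refine Finset.prod_eq_one fun a _ ↦ ?_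
      simp [(RingHom.mem_ker (f := ε)).mp (r a).2]
    · have : a ∈ Submodule.span A (s : Set A) := by
        rw [hs, Submodule.mem_iInf]
        intro n
        simpa using ha n
      refine Submodule.span_induction ?_ (by simp) (fun x y _ _ hx hy ↦ by simp [mul_add, hx, hy])
        (fun c x _ hx ↦ by rw [smul_eq_mul, mul_left_comm, hx, mul_zero]) this
      intro b hb
      have hrb : (r b : A) * b = b := hr b hb
      rw [← Finset.mul_prod_erase _ _ hb, mul_right_comm, sub_mul, one_mul, hrb, sub_self, zero_mul]
  obtain ⟨g, hg, hga⟩ := hkill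
  refine ⟨g, hg, fun R _ _ h hh ↦ ?_⟩
  let b := Algebra.TensorProduct.basis A (Module.Free.chooseBasis K R)
  have hb : g • h = 0 := by
    refine b.ext_elem fun i ↦ ?_
    simp only [map_smul, Finsupp.smul_apply, smul_eq_mul, map_zero, Finsupp.zero_apply]
    refine hga _ fun n ↦ ?_
    suffices h : ∀ c, b.repr (c * h) i ∈ m ^ n by simpa using h 1
    refine Submodule.span_induction ?_ (by simp) ?_ ?_ (hh n)
    · rintro _ ⟨a, ha, rfl⟩ c
      have : c * includeLeft (R := K) (S := K) a = a • c := by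
        rw [mul_comm, Algebra.smul_def]
        rfl
      erw [this]
      rw [map_smul]
      exact Ideal.mul_mem_right _ _ ha
    · intro x y _ _ hx hy c
      rw [mul_add, map_add]
      exact add_mem (hx c) (hy c)
    · intro c x _ hx d
      rw [smul_eq_mul, ← mul_assoc]
      exact hx _
  rwa [Algebra.smul_def] at hb

end Algebra

/-! ### Nonempty finite subsets -/

section Sets

/-- The set of nonempty finite subsets of a type. -/
abbrev FinSubset (α : Type u) : Type u := {A : Set α // A.Finite ∧ A.Nonempty}

namespace FinSubset

variable {α β : Type u}

/-- The singleton `{a}`. -/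
def single (a : α) : FinSubset α := ⟨{a}, Set.finite_singleton a, Set.singleton_nonempty a⟩

/-- The set `{a} ∪ A`. -/
def cons (a : α) (A : FinSubset α) : FinSubset α :=
  ⟨insert a A.1, A.2.1.insert a, Set.insert_nonempty _ _⟩

/-- The image of a nonempty finite subset. -/
def map (φ : α → β) (A : FinSubset α) : FinSubset β := ⟨φ '' A.1, A.2.1.image _, A.2.2.image _⟩

@[simp]
lemma map_single (φ : α → β) (a : α) : map φ (single a) = single (φ a) :=
  Subtype.ext (Set.image_singleton)

@[simp]
lemma map_cons (φ : α → β) (a : α) (A : FinSubset α) :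
    map φ (cons a A) = cons (φ a) (map φ A) :=
  Subtype.ext (Set.image_insert_eq)

lemma map_map {γ : Type u} (ψ : β → γ) (φ : α → β) (A : FinSubset α) :
    map ψ (map φ A) = map (fun a ↦ ψ (φ a)) A :=
  Subtype.ext (Set.image_image _ _ _)

lemma cons_of_mem {a : α} {A : FinSubset α} (h : a ∈ A.1) : cons a A = A :=
  Subtype.ext (Set.insert_eq_of_mem h)

@[simp]
lemma cons_single_self (a : α) : cons a (single a) = single a := cons_of_mem rfl

@[simp]
lemma cons_cons_self (a : α) (A : FinSubset α) : cons a (cons a A) = cons a A :=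
  cons_of_mem (Set.mem_insert a A.1)

lemma cons_comm (a b : α) (A : FinSubset α) : cons a (cons b A) = cons b (cons a A) :=
  Subtype.ext (Set.insert_comm _ _ _)

lemma cons_single_comm (a b : α) : cons a (single b) = cons b (single a) :=
  Subtype.ext (Set.pair_comm _ _)

/-- Induction on nonempty finite sets. -/
lemma induction {P : FinSubset α → Prop} (h₁ : ∀ a, P (.single a))
    (h₂ : ∀ a A, P A → P (.cons a A)) (A : FinSubset α) : P A := by
  obtain ⟨A, hA, hne⟩ := A
  induction A, hA using Set.Finite.induction_on with
  | empty => exact absurd hne Set.not_nonempty_empty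
  | @insert a B _ hB ih =>
    rcases B.eq_empty_or_nonempty with rfl | hne'
    · convert! h₁ a using 1
      exact Subtype.ext (by simp [single])
    · exact h₂ a ⟨B, hB, hne'⟩ (ih hne')

lemma map_surjective {φ : α → β} (h : Function.Surjective φ) :
    Function.Surjective (map φ) := by
  intro B
  refine ⟨B.map (Function.surjInv h), ?_⟩
  rw [map_map]
  simp only [Function.surjInv_eq h]
  exact Subtype.ext (Set.image_id _)

end FinSubset

end Sets

/-! ### Functions on prestacks -/

section Functions

variable {k : Type u} [Field k]

/-- The point of `F × Ran(X)` over `T` given by a point of `F` and a nonempty finite set of points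
of `X`. -/
def ranPoint {F : Prestack k} {X : Over (Spec (.of k))} {T : AffSch k} (s : F.obj (op T))
    (A : FinSubset (T.obj ⟶ X)) : (prod F (Ran X)).obj (op T) := (s, A)

/-- The point of `F × X` over `T` given by a point of `F` and a point of `X`. -/
def pairPoint {F : Prestack k} {X : Over (Spec (.of k))} {T : AffSch k} (s : F.obj (op T))
    (c : T.obj ⟶ X) : (prod F (points X)).obj (op T) := (s, c)

lemma map_ranPoint {F : Prestack k} {X : Over (Spec (.of k))} {T T' : AffSch k} (g : T' ⟶ T)
    (s : F.obj (op T)) (A : FinSubset (T.obj ⟶ X)) :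
    (prod F (Ran X)).map g.op (ranPoint s A) =
      ranPoint (F.map g.op s) (A.map fun y ↦ g.hom ≫ y) := rfl

lemma map_pairPoint {F : Prestack k} {X : Over (Spec (.of k))} {T T' : AffSch k} (g : T' ⟶ T)
    (s : F.obj (op T)) (c : T.obj ⟶ X) :
    (prod F (points X)).map g.op (pairPoint s c) = pairPoint (F.map g.op s) (g.hom ≫ c) := rfl

/-- Pullback of functions along a map of prestacks. -/
def functions.comap {F G : Prestack k} (η : F ⟶ G) : functions G →+* functions F where
  toFun f := ⟨fun T x ↦ f.1 T (η.app (op T) x), fun T T' g x ↦ by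
    have := ConcreteCategory.congr_hom (η.naturality g.op) x
    change f.1 T' ((F.map g.op ≫ η.app (op T')) x) = _
    rw [this]
    exact f.2 T T' g _⟩
  map_one' := rfl
  map_mul' _ _ := rfl
  map_zero' := rfl
  map_add' _ _ := rfl

/-- The map `((s, c), A) ↦ (s, {c} ∪ A)`. -/
def adjoin (F : Prestack k) (X : Over (Spec (.of k))) :
    prod (prod F (points X)) (Ran X) ⟶ prod F (Ran X) where
  app T := ↾fun x ↦ ranPoint (T := T.unop) x.1.1 (.cons x.1.2 x.2)
  naturality T T' g := by
    ext x
    exact Prod.ext rfl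
      (FinSubset.map_cons (fun y : T.unop.obj ⟶ X ↦ g.unop.hom ≫ y) x.1.2 x.2).symm

/-- The map `((s, c), A) ↦ (s, A)`. -/
def omitPoint (F : Prestack k) (X : Over (Spec (.of k))) :
    prod (prod F (points X)) (Ran X) ⟶ prod F (Ran X) where
  app T := ↾fun x ↦ (x.1.1, x.2)

end Functions

/-! ### Spectra of algebras as affine `k`-schemes -/

section Spec

variable {k : Type u} [Field k]

variable (k) in
/-- The spectrum of a `k`-algebra as an affine `k`-scheme. -/
def spec (R : Type u) [CommRing R] [Algebra k R] : AffSch k :=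
  ⟨Over.mk (Spec.map (CommRingCat.ofHom (algebraMap k R))),
    inferInstanceAs (IsAffine (Spec (.of R)))⟩

variable {R R' R'' : Type u} [CommRing R] [Algebra k R] [CommRing R'] [Algebra k R']
  [CommRing R''] [Algebra k R'']

/-- The map of spectra induced by a homomorphism of `k`-algebras. -/
def specMap (φ : R →ₐ[k] R') : spec k R' ⟶ spec k R :=
  ObjectProperty.homMk <| Over.homMk (Spec.map (CommRingCat.ofHom φ.toRingHom)) <| by
    change Spec.map _ ≫ Spec.map _ = Spec.map _
    rw [← Spec.map_comp, ← CommRingCat.ofHom_comp]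
    congr 2
    exact φ.comp_algebraMap

lemma specMap_comp (ψ : R' →ₐ[k] R'') (φ : R →ₐ[k] R') :
    specMap (ψ.comp φ) = specMap ψ ≫ specMap φ := by
  apply ObjectProperty.hom_ext
  apply Over.OverMorphism.ext
  exact Spec.map_comp (CommRingCat.ofHom φ.toRingHom) (CommRingCat.ofHom ψ.toRingHom)

lemma specMap_id : specMap (AlgHom.id k R) = 𝟙 _ := by
  apply ObjectProperty.hom_ext
  apply Over.OverMorphism.ext
  exact Spec.map_id (.of R)

/-- The value in `R` of a function on a prestack `F` at an `R`-point of `F`. -/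
def value {F : Prestack k} (f : functions F) (x : F.obj (op (spec k R))) : R :=
  (Scheme.ΓSpecIso (.of R)).hom (f.1 (spec k R) x)

lemma value_map {F : Prestack k} (f : functions F) (φ : R →ₐ[k] R')
    (x : F.obj (op (spec k R))) :
    value f (F.map (specMap φ).op x) = φ (value f x) := by
  have h := f.2 _ _ (specMap φ) x
  have := ConcreteCategory.congr_hom (Scheme.ΓSpecIso_naturality (CommRingCat.ofHom φ.toRingHom))
    (f.1 (spec k R) x)
  rw [value, h]
  exact this

lemma value_sub {F : Prestack k} (f f' : functions F) (x : F.obj (op (spec k R))) :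
    value (f - f') x = value f x - value f' x :=
  map_sub (Scheme.ΓSpecIso (.of R)).hom.hom _ _

end Spec

/-! ### Functions on the Ran space near a rational point of a chart -/

section Local

open scoped TensorProduct
open Algebra.TensorProduct (includeLeft includeRight)

variable {K A : Type u} [Field K] [CommRing A] [Algebra K A]
variable {X : Over (Spec (.of K))} (j : (spec K A).obj ⟶ X)
variable {R R' R'' : Type u} [CommRing R] [Algebra K R] [CommRing R'] [Algebra K R']
  [CommRing R''] [Algebra K R'']

/-- The `R`-point of `X` given by an `R`-point of a chart `j : Spec A ⟶ X`. -/
def chartPoint (φ : A →ₐ[K] R) : (spec K R).obj ⟶ X := (specMap φ).hom ≫ j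

lemma specMap_comp_chartPoint (ψ : R →ₐ[K] R') (φ : A →ₐ[K] R) :
    (specMap ψ).hom ≫ chartPoint j φ = chartPoint j (ψ.comp φ) := by
  rw [chartPoint, chartPoint, specMap_comp, ← Category.assoc]
  rfl

/-- The value of a function on `F × Ran(X)` at the restriction along `χ : R → R'` of an `R`-point
`s` of `F` and a set of `R'`-points of a chart of `X`. -/
def chartValue {F : Prestack K} (f : functions (prod F (Ran X))) (s : F.obj (op (spec K R)))
    (χ : R →ₐ[K] R') (Φ : FinSubset (A →ₐ[K] R')) : R' :=
  value f (ranPoint (F.map (specMap χ).op s) (Φ.map (chartPoint j)))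

variable {F : Prestack K} (f : functions (prod F (Ran X))) (s : F.obj (op (spec K R)))
  (χ : R →ₐ[K] R')

lemma map_chartValue (ψ : R' →ₐ[K] R'') (Φ : FinSubset (A →ₐ[K] R')) :
    ψ (chartValue j f s χ Φ) = chartValue j f s (ψ.comp χ) (Φ.map ψ.comp) := by
  rw [chartValue, ← value_map, chartValue, map_ranPoint, FinSubset.map_map, FinSubset.map_map]
  simp only [specMap_comp_chartPoint, specMap_comp, op_comp, Functor.map_comp]
  rfl

lemma chartValue_adjoin (φ : A →ₐ[K] R') (χ' : R' →ₐ[K] R'') (Φ : FinSubset (A →ₐ[K] R'')) :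
    chartValue j (functions.comap (adjoin F X) f)
      (pairPoint (F.map (specMap χ).op s) (chartPoint j φ)) χ' Φ =
      chartValue j f s (χ'.comp χ) (Φ.cons (χ'.comp φ)) := by
  rw [chartValue, map_pairPoint, specMap_comp_chartPoint, chartValue, FinSubset.map_cons,
    specMap_comp, op_comp, Functor.map_comp]
  rfl

lemma chartValue_omitPoint (φ : A →ₐ[K] R') (χ' : R' →ₐ[K] R'') (Φ : FinSubset (A →ₐ[K] R'')) :
    chartValue j (functions.comap (omitPoint F X) f)
      (pairPoint (F.map (specMap χ).op s) (chartPoint j φ)) χ' Φ =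
      chartValue j f s (χ'.comp χ) Φ := by
  rw [chartValue, chartValue, specMap_comp, op_comp, Functor.map_comp]
  rfl

lemma chartValue_sub (f' : functions (prod F (Ran X))) (Φ : FinSubset (A →ₐ[K] R')) :
    chartValue j (f - f') s χ Φ = chartValue j f s χ Φ - chartValue j f' s χ Φ :=
  value_sub _ _ _

variable (R) in
/-- The constant `R`-point of a chart given by a rational point. -/
def constPoint (ε : A →ₐ[K] K) : A →ₐ[K] R := (Algebra.ofId K R).comp ε

lemma comp_constPoint (ε : A →ₐ[K] K) (ψ : R →ₐ[K] R') :
    ψ.comp (constPoint R ε) = constPoint R' ε := by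
  ext a
  simp [constPoint, Algebra.ofId_apply]

lemma evalSnd_comp_includeLeft (ε : A →ₐ[K] K) :
    (evalSnd ε R).comp includeLeft = includeLeft := by
  ext a; simp

lemma evalSnd_comp_includeRight (ε : A →ₐ[K] K) :
    (evalSnd ε R).comp includeRight = includeRight.comp (evalLeft ε R) := by
  ext a <;> simp [Algebra.algebraMap_eq_smul_one, -Algebra.TensorProduct.algebraMap_apply]

lemma evalLeft_comp_includeLeft (ε : A →ₐ[K] K) :
    (evalLeft ε R).comp includeLeft = constPoint R ε := by
  ext a
  simp [constPoint, Algebra.ofId_apply, -AlgHom.commutes]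

lemma evalLeft_comp_includeRight (ε : A →ₐ[K] K) :
    (evalLeft ε R).comp includeRight = AlgHom.id K R := by
  ext a; simp

lemma diagonal_comp_includeLeft : (diagonal (K := K) A R).comp includeLeft = includeLeft := by
  ext a; simp

lemma diagonal_comp_includeRight :
    (diagonal (K := K) A R).comp includeRight = AlgHom.id K _ := by
  ext a <;> simp

/-- The difference `f({y}) - f({y, x})`, where `y` is the universal point of the chart and `x` is a
fixed rational point, vanishes to infinite order at `y = x`. -/
lemma chartValue_single_sub_mem (ε : A →ₐ[K] K) (n : ℕ) :
    chartValue j f s (includeRight : R →ₐ[K] A ⊗[K] R) (.single includeLeft) -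
      chartValue j f s (includeRight : R →ₐ[K] A ⊗[K] R)
        (.cons includeLeft (.single (constPoint _ ε))) ∈
      (RingHom.ker ε ^ n).map (includeLeft : A →ₐ[K] A ⊗[K] R) := by
  refine mem_map_pow_of_forall_exists_diagonal R ε (fun R _ _ h ↦
    ∃ (F : Prestack K) (f : functions (prod F (Ran X))) (s : F.obj (op (spec K R))),
      h = chartValue j f s (includeRight : R →ₐ[K] A ⊗[K] R) (.single includeLeft) -
        chartValue j f s (includeRight : R →ₐ[K] A ⊗[K] R)
          (.cons includeLeft (.single (constPoint _ ε)))) ?_ n ⟨F, f, s, rfl⟩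
  rintro R _ _ _ ⟨F, f, s, rfl⟩
  -- Adjoin a second universal point `y₁` to all sets.
  refine ⟨_, ⟨_, functions.comap (adjoin F X) f,
    pairPoint (F.map (specMap includeRight).op s) (chartPoint j includeLeft), rfl⟩, ?_, ?_⟩
  · simp only [chartValue_adjoin, map_sub, map_chartValue, FinSubset.map_cons,
      FinSubset.map_single, ← AlgHom.comp_assoc, evalSnd_comp_includeLeft, comp_constPoint,
      evalSnd_comp_includeRight]
    simp only [AlgHom.comp_assoc, evalLeft_comp_includeLeft, evalLeft_comp_includeRight,
      AlgHom.comp_id, comp_constPoint]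
    rw [FinSubset.cons_comm, FinSubset.cons_single_self, FinSubset.cons_single_comm, sub_self]
  · simp only [chartValue_adjoin, map_sub, map_chartValue, FinSubset.map_cons,
      FinSubset.map_single, ← AlgHom.comp_assoc, diagonal_comp_includeLeft, comp_constPoint,
      diagonal_comp_includeRight, AlgHom.id_comp, FinSubset.cons_single_self,
      FinSubset.cons_cons_self]

/-- The difference `f({x}) - f({y, x})`, where `y` is the universal point of the chart and `x` is a
fixed rational point, vanishes to infinite order at `y = x`. -/
lemma chartValue_single_const_sub_mem (ε : A →ₐ[K] K) (n : ℕ) :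
    chartValue j f s (includeRight : R →ₐ[K] A ⊗[K] R) (.single (constPoint _ ε)) -
      chartValue j f s (includeRight : R →ₐ[K] A ⊗[K] R)
        (.cons includeLeft (.single (constPoint _ ε))) ∈
      (RingHom.ker ε ^ n).map (includeLeft : A →ₐ[K] A ⊗[K] R) := by
  refine mem_map_pow_of_forall_exists_diagonal R ε (fun R _ _ h ↦
    ∃ (F : Prestack K) (f : functions (prod F (Ran X))) (s : F.obj (op (spec K R))),
      h = chartValue j f s (includeRight : R →ₐ[K] A ⊗[K] R) (.single (constPoint _ ε)) -
        chartValue j f s (includeRight : R →ₐ[K] A ⊗[K] R)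
          (.cons includeLeft (.single (constPoint _ ε)))) ?_ n ⟨F, f, s, rfl⟩
  rintro R _ _ _ ⟨F, f, s, rfl⟩
  -- Take the difference of the functions before and after adjoining a second universal point.
  refine ⟨_, ⟨_, functions.comap (omitPoint F X) f - functions.comap (adjoin F X) f,
    pairPoint (F.map (specMap includeRight).op s) (chartPoint j includeLeft), rfl⟩, ?_, ?_⟩
  · simp only [chartValue_sub, chartValue_adjoin, chartValue_omitPoint, map_sub, map_chartValue,
      FinSubset.map_cons, FinSubset.map_single, ← AlgHom.comp_assoc, evalSnd_comp_includeLeft,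
      comp_constPoint, evalSnd_comp_includeRight]
    simp only [AlgHom.comp_assoc, evalLeft_comp_includeLeft, evalLeft_comp_includeRight,
      AlgHom.comp_id, comp_constPoint]
    rw [FinSubset.cons_comm, FinSubset.cons_single_self]
    simp
  · simp only [chartValue_sub, chartValue_adjoin, chartValue_omitPoint, map_sub, map_chartValue,
      FinSubset.map_cons, FinSubset.map_single, ← AlgHom.comp_assoc, diagonal_comp_includeLeft,
      comp_constPoint, diagonal_comp_includeRight, AlgHom.id_comp, FinSubset.cons_cons_self,
      sub_self, sub_zero]

/-- A function on `F × Ran(X)` is constant along one-point subsets near any rational point of a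
Noetherian chart, on a neighbourhood that does not depend on the function. -/
lemma exists_value_single_eq [IsNoetherianRing A] (ε : A →ₐ[K] K) :
    ∃ g : A, ε g = 1 ∧ ∀ (F : Prestack K) (f : functions (prod F (Ran X)))
      (R : Type u) [CommRing R] [Algebra K R] (s : F.obj (op (spec K R))) (φ : A →ₐ[K] R),
      IsUnit (φ g) → value f (ranPoint s (.single (chartPoint j φ))) =
        value f (ranPoint s (.single (chartPoint j (constPoint R ε)))) := by
  obtain ⟨g, hg, H⟩ := exists_tmul_one_mul_eq_zero ε
  refine ⟨g, hg, fun F f R _ _ s φ hφ ↦ ?_⟩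
  let ψ : A ⊗[K] R →ₐ[K] R :=
    Algebra.TensorProduct.lift φ (AlgHom.id K R) fun _ _ ↦ .all _ _
  have hψr : ψ.comp includeRight = AlgHom.id K R := by ext; simp [ψ]
  have hψl : ψ.comp includeLeft = φ := by ext; simp [ψ]
  have key : ∀ h : A ⊗[K] R,
      (∀ n, h ∈ (RingHom.ker ε ^ n).map (includeLeft : A →ₐ[K] A ⊗[K] R)) → ψ h = 0 := by
    intro h hh
    have := congr(ψ $(H R h hh))
    simpa [ψ, hφ.mul_right_eq_zero] using this
  have h₁ := key _ (chartValue_single_sub_mem j f s ε)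
  have h₂ := key _ (chartValue_single_const_sub_mem j f s ε)
  have hv : ∀ χ : A →ₐ[K] R, value f (ranPoint s (.single (chartPoint j χ))) =
      chartValue j f s (AlgHom.id K R) (.single χ) := by
    intro χ
    rw [chartValue, specMap_id, op_id, CategoryTheory.Functor.map_id, FinSubset.map_single]
    rfl
  rw [hv, hv]
  simp only [map_sub, map_chartValue, hψr, hψl, FinSubset.map_cons, FinSubset.map_single,
    comp_constPoint] at h₁ h₂
  exact (sub_eq_zero.mp h₁).trans (sub_eq_zero.mp h₂).symm

end Local

/-! ### Affine `k`-schemes and local equality of functions -/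

section AffSch

variable {k : Type u} [Field k]

/-- Every affine `k`-scheme is the spectrum of a `k`-algebra. -/
lemma exists_spec_iso (T : AffSch k) :
    ∃ (R : Type u) (_ : CommRing R) (_ : Algebra k R) (e : spec k R ⟶ T), IsIso e.hom.left := by
  have : IsAffine T.obj.left := T.property
  let φ := Spec.preimage (R := .of k) (T.obj.left.isoSpec.inv ≫ T.obj.hom)
  let : Algebra k Γ(T.obj.left, ⊤) := φ.hom.toAlgebra
  refine ⟨Γ(T.obj.left, ⊤), inferInstance, inferInstance,
    ObjectProperty.homMk (Over.homMk T.obj.left.isoSpec.inv ?_), ?_⟩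
  · exact (Spec.map_preimage _).symm
  · exact inferInstanceAs (IsIso T.obj.left.isoSpec.inv)

/-- Functions on an affine scheme that agree locally are equal. -/
lemma eq_of_forall_exists_openImmersion (T : AffSch k) (a b : Γ(T.obj.left, ⊤))
    (h : ∀ t : T.obj.left, ∃ (T' : AffSch k) (i : T' ⟶ T), IsOpenImmersion i.hom.left ∧
      t ∈ Set.range i.hom.left ∧ i.hom.left.appTop a = i.hom.left.appTop b) : a = b := by
  refine T.obj.left.IsSheaf.section_ext fun t _ ↦ ?_
  obtain ⟨T', i, hi, ht, hab⟩ := h t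
  refine ⟨i.hom.left.opensRange, le_top, ht, ?_⟩
  have := i.hom.left.isIso_app i.hom.left.opensRange le_rfl
  apply (ConcreteCategory.bijective_of_isIso (i.hom.left.app i.hom.left.opensRange)).1
  have H : ∀ c, i.hom.left.app i.hom.left.opensRange
      (T.obj.left.presheaf.map (homOfLE le_top).op c) =
      T'.obj.left.presheaf.map (homOfLE le_top).op (i.hom.left.appTop c) := fun c ↦
    ConcreteCategory.congr_hom (i.hom.left.naturality (homOfLE le_top).op) c
  exact (H a).trans ((congrArg _ hab).trans (H b).symm)

lemma exists_affineOpens_le {S : Scheme.{u}} (U : S.Opens) (x : S) (hx : x ∈ U) :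
    ∃ W : S.affineOpens, x ∈ W.1 ∧ W.1 ≤ U := by
  obtain ⟨W, hW, hxW, hWU⟩ := S.isBasis_affineOpens.exists_subset_of_mem_open hx U.2
  obtain ⟨W, hW', rfl⟩ := hW
  exact ⟨⟨W, hW'⟩, hxW, hWU⟩

/-- An affine open subset of a `k`-scheme as an affine `k`-scheme. -/
def affineOpen (S : Over (Spec (.of k))) (V : S.left.affineOpens) : AffSch k :=
  ⟨Over.mk (V.1.ι ≫ S.hom), V.2⟩

/-- The tautological point of a `k`-scheme over an affine open subset. -/
def affineOpenι (S : Over (Spec (.of k))) (V : S.left.affineOpens) : (affineOpen S V).obj ⟶ S :=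
  Over.homMk V.1.ι

lemma spec_self_hom : (spec k k).obj.hom = 𝟙 (Spec (.of k)) := by
  change Spec.map (CommRingCat.ofHom (algebraMap k k)) = _
  rw [Algebra.algebraMap_self, CommRingCat.ofHom_id, Spec.map_id]

/-- The structure map of an affine `k`-scheme. -/
def toBase (T : AffSch k) : T ⟶ spec k k :=
  ObjectProperty.homMk <| Over.homMk T.obj.hom <| by
    rw [spec_self_hom]
    exact Category.comp_id _

/-- The scheme `Spec k` is terminal among affine `k`-schemes. -/
lemma hom_spec_self_ext {T : AffSch k} (a b : T ⟶ spec k k) : a = b := by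
  have H : ∀ a : T ⟶ spec k k, a.hom.left = T.obj.hom := fun a ↦ by
    have := Over.w a.hom
    rw [spec_self_hom] at this
    exact (Category.comp_id _).symm.trans this
  apply ObjectProperty.hom_ext
  apply Over.OverMorphism.ext
  rw [H, H]

/-- The constant `T`-point of `X` given by a rational point. -/
def const {X : Over (Spec (.of k))} (x : (spec k k).obj ⟶ X) (T : AffSch k) : T.obj ⟶ X :=
  (toBase T).hom ≫ x

lemma comp_const {X : Over (Spec (.of k))} (x : (spec k k).obj ⟶ X) {T T' : AffSch k}
    (g : T' ⟶ T) : g.hom ≫ const x T = const x T' := by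
  rw [const, const, ← Category.assoc]
  exact congrArg (· ≫ x) congr(($(hom_spec_self_ext (g ≫ toBase T) (toBase T'))).hom)

end AffSch

/-! ### Neighbourhoods of rational points -/

section Near

variable {K : Type u} [Field K]

lemma map_ranPoint_single {F : Prestack K} {X : Over (Spec (.of K))} {T T' : AffSch K}
    (f : functions (prod F (Ran X))) (g : T' ⟶ T) (s : F.obj (op T)) (y : T.obj ⟶ X) :
    g.hom.left.appTop (f.1 T (ranPoint s (.single y))) =
      f.1 T' (ranPoint (F.map g.op s) (.single (g.hom ≫ y))) := by
  rw [← f.2, map_ranPoint, FinSubset.map_single]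

/-- A point of `X` over a `K`-algebra whose range lies in an open chart comes from the chart. -/
lemma exists_chartPoint_eq {A : Type u} [CommRing A] [Algebra K A] {X : Over (Spec (.of K))}
    (j : (spec K A).obj ⟶ X) [IsOpenImmersion j.left] {R : Type u} [CommRing R] [Algebra K R]
    (y : (spec K R).obj ⟶ X) (hy : Set.range y.left ⊆ Set.range j.left) :
    ∃ φ : A →ₐ[K] R, y = chartPoint j φ := by
  let l := IsOpenImmersion.lift j.left y.left hy
  let ψ : CommRingCat.of A ⟶ .of R := Spec.preimage l
  have hψ : Spec.map ψ ≫ j.left = y.left :=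
    (congrArg (· ≫ j.left) (Spec.map_preimage l)).trans
      (IsOpenImmersion.lift_fac j.left y.left hy)
  have hcomp : CommRingCat.ofHom (algebraMap K A) ≫ ψ = CommRingCat.ofHom (algebraMap K R) := by
    apply Spec.map_injective
    rw [Spec.map_comp]
    have h₁ : j.left ≫ X.hom = Spec.map (CommRingCat.ofHom (algebraMap K A)) := Over.w j
    have h₂ : y.left ≫ X.hom = Spec.map (CommRingCat.ofHom (algebraMap K R)) := Over.w y
    rw [← h₁, ← h₂, ← hψ]
    rfl
  refine ⟨⟨ψ.hom, fun a ↦ ConcreteCategory.congr_hom hcomp a⟩, ?_⟩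
  apply Over.OverMorphism.ext
  exact hψ.symm

/-- Around each rational point `x` of a scheme that is locally of finite type there is a single open
subset on which every function on every `F × Ran(X)` takes the same value at `{y}` and at `{x}`. -/
lemma exists_opens_value_eq {X : Over (Spec (.of K))} [LocallyOfFiniteType X.hom]
    (x : (spec K K).obj ⟶ X) :
    ∃ U : X.left.Opens, Set.range x.left ⊆ (U : Set X.left) ∧
      ∀ (F : Prestack K) (f : functions (prod F (Ran X))) (T : AffSch K)
        (s : F.obj (op T)) (y : T.obj ⟶ X), Set.range y.left ⊆ (U : Set X.left) →
        f.1 T (ranPoint s (.single y)) = f.1 T (ranPoint s (.single (const x T))) := by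
  let p : X.left ⟶ Spec (.of K) := X.hom
  have hp : LocallyOfFiniteType p := ‹_›
  have : Subsingleton (spec K K).obj.left :=
    inferInstanceAs (Subsingleton (PrimeSpectrum K))
  have hne : Nonempty (spec K K).obj.left := inferInstanceAs (Nonempty (PrimeSpectrum K))
  obtain ⟨t⟩ := hne
  have hrange : Set.range x.left = {x.left t} :=
    Set.eq_singleton_iff_unique_mem.mpr ⟨⟨t, rfl⟩, by
      rintro _ ⟨t', rfl⟩
      exact congrArg _ (Subsingleton.elim _ _)⟩
  obtain ⟨⟨V, hV'⟩, hxV, -⟩ := exists_affineOpens_le ⊤ (x.left t) trivial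
  have hV : IsAffineOpen V := hV'
  let φ := Spec.preimage (R := .of K) (hV.fromSpec ≫ p)
  let : Algebra K Γ(X.left, V) := φ.hom.toAlgebra
  have hφ : Spec.map (CommRingCat.ofHom (algebraMap K Γ(X.left, V))) = hV.fromSpec ≫ p :=
    Spec.map_preimage _
  have hft : Algebra.FiniteType K Γ(X.left, V) := by
    have : LocallyOfFiniteType (Spec.map (CommRingCat.ofHom (algebraMap K Γ(X.left, V)))) := by
      rw [hφ]; infer_instance
    exact HasRingHomProperty.Spec_iff.mp this
  have : IsNoetherianRing Γ(X.left, V) := Algebra.FiniteType.isNoetherianRing K _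
  let j : (spec K Γ(X.left, V)).obj ⟶ X := Over.homMk hV.fromSpec hφ.symm
  have hj : IsOpenImmersion j.left := inferInstanceAs (IsOpenImmersion hV.fromSpec)
  have hjr : Set.range j.left = (V : Set X.left) := hV.range_fromSpec
  obtain ⟨ε, hε⟩ := exists_chartPoint_eq j x (by rw [hjr, hrange]; simpa using hxV)
  obtain ⟨g, hg, H⟩ := exists_value_single_eq j ε
  have hunit : ∀ (R : Type u) [CommRing R] [Algebra K R] (φ : Γ(X.left, V) →ₐ[K] R),
      Set.range (chartPoint j φ).left ⊆ (X.left.basicOpen g : Set X.left) ↔ IsUnit (φ g) := by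
    intro R _ _ φ
    have hmem : ∀ q : PrimeSpectrum R,
        (chartPoint j φ).left q ∈ X.left.basicOpen g ↔ φ g ∉ q.asIdeal := by
      intro q
      change Spec.map (CommRingCat.ofHom φ.toRingHom) q ∈ hV.fromSpec ⁻¹ᵁ X.left.basicOpen g ↔ _
      rw [hV.fromSpec_preimage_basicOpen]
      rfl
    refine ⟨fun h ↦ ?_, fun h ↦ ?_⟩
    · by_contra hu
      obtain ⟨M, hM, hgM⟩ := exists_max_ideal_of_mem_nonunits hu
      exact (hmem ⟨M, hM.isPrime⟩).mp (h ⟨_, rfl⟩) hgM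
    · rintro _ ⟨q, rfl⟩
      exact (hmem q).mpr fun hq ↦ q.2.ne_top (Ideal.eq_top_of_isUnit_mem _ hq h)
  refine ⟨X.left.basicOpen g, ?_, fun F f T s y hy ↦ ?_⟩
  · rw [hε, hunit, hg]
    exact isUnit_one
  · obtain ⟨R, _, _, e, he⟩ := exists_spec_iso T
    have : IsIso e.hom.left.appTop := inferInstanceAs (IsIso (e.hom.left.app ⊤))
    apply (ConcreteCategory.bijective_of_isIso e.hom.left.appTop).1
    rw [map_ranPoint_single, map_ranPoint_single, comp_const]
    have hy' : Set.range (e.hom ≫ y).left ⊆ (X.left.basicOpen g : Set X.left) := by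
      refine Set.Subset.trans ?_ hy
      rintro _ ⟨t, rfl⟩
      exact ⟨e.hom.left t, rfl⟩
    obtain ⟨ψ, hψ⟩ := exists_chartPoint_eq j (e.hom ≫ y)
      (hy'.trans (by rw [hjr]; exact X.left.basicOpen_le g))
    have hx : const x (spec K R) = chartPoint j (constPoint R ε) := by
      rw [hε, const, chartPoint, chartPoint, constPoint, specMap_comp, ← Category.assoc]
      exact congrArg (· ≫ j)
        congr(($(hom_spec_self_ext (toBase (spec K R)) (specMap (Algebra.ofId K R)))).hom ≫
          (specMap ε).hom)
    rw [hψ, hunit] at hy'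
    rw [hψ, hx]
    exact (ConcreteCategory.bijective_of_isIso (Scheme.ΓSpecIso (.of R)).hom).1
      (H F f R (F.map e.op s) ψ hy')

end Near

/-! ### Connected schemes over an algebraically closed field -/

section AlgClosed

variable {K : Type u} [Field K] [IsAlgClosed K]

/-- Over an algebraically closed field, every nonempty locally closed subset contains a rational
point. -/
lemma exists_range_subset {X : Over (Spec (.of K))} [LocallyOfFiniteType X.hom]
    {Z : Set X.left} (hZ : IsLocallyClosed Z) (hne : Z.Nonempty) :
    ∃ x : (spec K K).obj ⟶ X, Set.range x.left ⊆ Z := by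
  let p : X.left ⟶ Spec (.of K) := X.hom
  have hp : LocallyOfFiniteType p := ‹_›
  have : JacobsonSpace X.left := LocallyOfFiniteType.jacobsonSpace p
  obtain ⟨z, hz, hzc⟩ := nonempty_inter_closedPoints hne hZ
  refine ⟨Over.homMk (pointOfClosedPoint p z hzc) ?_, ?_⟩
  · rw [spec_self_hom]
    exact pointOfClosedPoint_comp p z hzc
  · rintro _ ⟨t, rfl⟩
    exact (pointOfClosedPoint_apply p z hzc t).symm ▸ hz

/-- A function on `F × Ran(X)` is constant along one-point subsets if `X` is connected. -/
lemma value_single_eq_const {X : Over (Spec (.of K))} [LocallyOfFiniteType X.hom]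
    [ConnectedSpace X.left] (x₀ : (spec K K).obj ⟶ X) {F : Prestack K}
    (f : functions (prod F (Ran X))) (T : AffSch K) (s : F.obj (op T)) (y : T.obj ⟶ X) :
    f.1 T (ranPoint s (.single y)) = f.1 T (ranPoint s (.single (const x₀ T))) := by
  choose U hxU hU using exists_opens_value_eq (X := X)
  have hne : Nonempty (spec K K).obj.left := ⟨(⊥ : PrimeSpectrum K)⟩
  have hcover : ∀ z, ∃ x, z ∈ U x := by
    by_contra! hz
    obtain ⟨z, hz⟩ := hz
    have hcl : IsClosed (⋃ x, (U x : Set X.left))ᶜ :=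
      (isOpen_iUnion fun x ↦ (U x).2).isClosed_compl
    obtain ⟨x, hx⟩ := exists_range_subset hcl.isLocallyClosed ⟨z, by simpa using hz⟩
    obtain ⟨t⟩ := hne
    exact hx ⟨t, rfl⟩ (Set.mem_iUnion.mpr ⟨x, hxU x ⟨t, rfl⟩⟩)
  -- Two rational points are equivalent if every function takes the same values at them.
  let r (x x' : (spec K K).obj ⟶ X) : Prop :=
    ∀ (F : Prestack K) (f : functions (prod F (Ran X))) (T : AffSch K) (s : F.obj (op T)),
      f.1 T (ranPoint s (.single (const x T))) = f.1 T (ranPoint s (.single (const x' T)))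
  have hr : ∀ z x, Set.range z.left ⊆ (U x : Set X.left) → r z x := by
    intro z x hzx F f T s
    refine hU x F f T s _ (Set.Subset.trans ?_ hzx)
    rintro _ ⟨t, rfl⟩
    exact ⟨(toBase T).hom.left t, rfl⟩
  have hmeet : ∀ x x', ((U x : Set X.left) ∩ U x').Nonempty → r x x' := by
    intro x x' h
    obtain ⟨z, hz⟩ := exists_range_subset ((U x).2.inter (U x').2).isLocallyClosed h
    intro F f T s
    exact (hr z x (fun _ h ↦ (hz h).1) F f T s).symm.trans
      (hr z x' (fun _ h ↦ (hz h).2) F f T s)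
  let W : Set X.left := ⋃ x ∈ {x | r x₀ x}, (U x : Set X.left)
  have hW : IsClopen W := by
    refine ⟨?_, isOpen_biUnion fun x _ ↦ (U x).2⟩
    have : Wᶜ = ⋃ x ∈ {x | ¬ r x₀ x}, (U x : Set X.left) := by
      ext z
      simp only [W, Set.mem_compl_iff, Set.mem_iUnion, Set.mem_ofPred_eq, not_exists]
      constructor
      · intro h
        obtain ⟨x, hx⟩ := hcover z
        exact ⟨x, fun hx' ↦ h x hx' hx, hx⟩
      · rintro ⟨x, hx, hzx⟩ x' hx' hzx'
        exact hx fun F f T s ↦ (hx' F f T s).trans (hmeet x' x ⟨z, hzx', hzx⟩ F f T s)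
    rw [← isOpen_compl_iff, this]
    exact isOpen_biUnion fun x _ ↦ (U x).2
  have hWne : W.Nonempty := by
    obtain ⟨t⟩ := hne
    exact ⟨x₀.left t, Set.mem_biUnion (fun _ _ _ _ ↦ rfl : r x₀ x₀) (hxU x₀ ⟨t, rfl⟩)⟩
  have hWu := hW.eq_univ hWne
  refine eq_of_forall_exists_openImmersion T _ _ fun t ↦ ?_
  have : y.left t ∈ W := hWu ▸ Set.mem_univ _
  simp only [W, Set.mem_iUnion, Set.mem_ofPred_eq] at this
  obtain ⟨x, hx, hyx⟩ := this
  obtain ⟨V, htV, hVU⟩ := exists_affineOpens_le (y.left ⁻¹ᵁ U x) t hyx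
  refine ⟨affineOpen T.obj V, ObjectProperty.homMk (affineOpenι T.obj V),
    inferInstanceAs (IsOpenImmersion V.1.ι), ⟨⟨t, htV⟩, rfl⟩, ?_⟩
  rw [map_ranPoint_single, map_ranPoint_single, comp_const]
  refine (hU x F f _ _ _ ?_).trans (hx F f _ _).symm
  rintro _ ⟨v, rfl⟩
  exact hVU v.2

/-- A function on `F × Ran(X)` does not depend on the point of `Ran(X)`: replace the points of a
finite set one at a time by a fixed rational point. -/
lemma value_eq_of_isAlgClosed {X : Over (Spec (.of K))} [LocallyOfFiniteType X.hom]
    [ConnectedSpace X.left] {F : Prestack K} (f : functions (prod F (Ran X))) (T : AffSch K)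
    (s : F.obj (op T)) (A A' : FinSubset (T.obj ⟶ X)) :
    f.1 T (ranPoint s A) = f.1 T (ranPoint s A') := by
  obtain ⟨x₀, -⟩ := exists_range_subset (X := X) isOpen_univ.isLocallyClosed Set.univ_nonempty
  suffices h : ∀ A : FinSubset (T.obj ⟶ X), ∀ (F : Prestack K) (f : functions (prod F (Ran X)))
      (s : F.obj (op T)), f.1 T (ranPoint s A) = f.1 T (ranPoint s (.single (const x₀ T))) from
    (h A F f s).trans (h A' F f s).symm
  intro A
  induction A using FinSubset.induction with
  | h₁ a => exact fun F f s ↦ value_single_eq_const x₀ f T s a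
  | h₂ a A ih =>
    intro F f s
    have hadj : ∀ (c : T.obj ⟶ X) (B : FinSubset (T.obj ⟶ X)),
        f.1 T (ranPoint s (.cons c B)) =
          (functions.comap (adjoin F X) f).1 T (ranPoint (pairPoint s c) B) := fun _ _ ↦ rfl
    rw [hadj, ih, ← hadj, FinSubset.cons_single_comm, hadj, value_single_eq_const x₀, ← hadj,
      FinSubset.cons_single_self]

end AlgClosed

/-! ### Descent from the algebraic closure -/

section BaseChange

open Limits

variable (k K : Type u) [Field k] [Field K] [Algebra k K]

/-- Restriction of scalars for affine schemes along a field extension. -/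
def resScalars : AffSch K ⥤ AffSch k where
  obj T := ⟨Over.mk (T.obj.hom ≫ Spec.map (CommRingCat.ofHom (algebraMap k K))), T.property⟩
  map g := ObjectProperty.homMk (Over.homMk g.hom.left (by
    have := Over.w g.hom
    exact congrArg (· ≫ Spec.map (CommRingCat.ofHom (algebraMap k K))) this))

variable {k} in
/-- The base change of a `k`-scheme along a field extension `K / k`. -/
def extScalars (X : Over (Spec (.of k))) : Over (Spec (.of K)) :=
  Over.mk (pullback.snd X.hom (Spec.map (CommRingCat.ofHom (algebraMap k K))) : _ ⟶ Spec (.of K))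

variable {k K}

/-- A `K`-point of the base change of `X` gives a `k`-point of `X`. -/
def restrictPoint {X : Over (Spec (.of k))} {T : AffSch K} (y : T.obj ⟶ extScalars K X) :
    ((resScalars k K).obj T).obj ⟶ X :=
  Over.homMk (y.left ≫ pullback.fst _ _) (by
    have h := Over.w y
    have := pullback.condition (f := X.hom) (g := Spec.map (CommRingCat.ofHom (algebraMap k K)))
    exact (Category.assoc _ _ _).trans ((congrArg (y.left ≫ ·) this).trans
      ((Category.assoc _ _ _).symm.trans (congrArg (· ≫ _) h))))

lemma restrictPoint_surjective {X : Over (Spec (.of k))} {T : AffSch K} :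
    Function.Surjective (restrictPoint : (T.obj ⟶ extScalars K X) → _) := by
  intro y
  refine ⟨Over.homMk (pullback.lift y.left T.obj.hom (Over.w y)) (pullback.lift_snd _ _ _), ?_⟩
  apply Over.OverMorphism.ext
  exact pullback.lift_fst _ _ _

lemma map_restrictPoint {X : Over (Spec (.of k))} {T T' : AffSch K} (g : T' ⟶ T)
    (A : FinSubset (T.obj ⟶ extScalars K X)) :
    (A.map fun y ↦ g.hom ≫ y).map restrictPoint =
      (A.map restrictPoint).map fun y ↦ ((resScalars k K).map g).hom ≫ y := by
  rw [FinSubset.map_map, FinSubset.map_map]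
  congr 1

/-- The base change of a function on `F × Ran(X)` along a field extension. -/
def baseChange {F : Prestack k} {X : Over (Spec (.of k))} (f : functions (prod F (Ran X))) :
    functions (prod ((resScalars k K).op ⋙ F) (Ran (extScalars K X))) :=
  ⟨fun T x ↦ f.1 ((resScalars k K).obj T)
      (ranPoint x.1 (FinSubset.map (restrictPoint (k := k) (T := T)) x.2)),
    fun T _ g x ↦ (congrArg (fun B ↦ f.1 _ (ranPoint (F.map ((resScalars k K).map g).op x.1) B))
      (map_restrictPoint g x.2)).trans (f.2 _ _ ((resScalars k K).map g)
        (ranPoint x.1 (FinSubset.map (restrictPoint (k := k) (T := T)) x.2)))⟩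

lemma appTop_injective_of_injective {R R' : CommRingCat.{u}} (φ : R ⟶ R')
    (h : Function.Injective φ) : Function.Injective (Spec.map φ).appTop := by
  intro a b hab
  have key : ∀ c, (Scheme.ΓSpecIso R').hom ((Spec.map φ).appTop c) =
      φ ((Scheme.ΓSpecIso R).hom c) :=
    fun c ↦ ConcreteCategory.congr_hom (Scheme.ΓSpecIso_naturality φ) c
  exact (ConcreteCategory.bijective_of_isIso (Scheme.ΓSpecIso R).hom).1
    (h ((key a).symm.trans ((congrArg _ hab).trans (key b))))

open scoped TensorProduct in
/-- A function on `F × Ran(X)` does not depend on the point of `Ran(X)`, over an arbitrary field: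
both values may be compared after base change to the algebraic closure. -/
lemma value_eq {X : Over (Spec (.of k))} [LocallyOfFiniteType X.hom] [GeometricallyConnected X.hom]
    {F : Prestack k} (f : functions (prod F (Ran X))) (T : AffSch k)
    (s : F.obj (op T)) (A A' : FinSubset (T.obj ⟶ X)) :
    f.1 T (ranPoint s A) = f.1 T (ranPoint s A') := by
  obtain ⟨R, _, _, e, he⟩ := exists_spec_iso T
  have : IsIso e.hom.left.appTop := inferInstanceAs (IsIso (e.hom.left.app ⊤))
  apply (ConcreteCategory.bijective_of_isIso e.hom.left.appTop).1
  let K := AlgebraicClosure k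
  let h : (resScalars k K).obj (spec K (K ⊗[k] R)) ⟶ spec k R :=
    ObjectProperty.homMk <| Over.homMk
      (Spec.map (CommRingCat.ofHom
        (Algebra.TensorProduct.includeRight : R →ₐ[k] K ⊗[k] R).toRingHom))
      (by
        change Spec.map _ ≫ Spec.map _ = Spec.map _ ≫ Spec.map _
        rw [← Spec.map_comp, ← Spec.map_comp, ← CommRingCat.ofHom_comp, ← CommRingCat.ofHom_comp]
        congr 2
        ext a
        exact (Algebra.TensorProduct.includeRight : R →ₐ[k] K ⊗[k] R).commutes a)
  have hinj : Function.Injective h.hom.left.appTop :=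
    appTop_injective_of_injective _
      (Algebra.TensorProduct.includeRight_injective (algebraMap k K).injective)
  apply hinj
  have hX : ConnectedSpace (extScalars K X).left :=
    GeometricallyConnected.geometrically_connectedSpace (f := X.hom) _ _ _ (.of_hasPullback _ _)
  have hft : LocallyOfFiniteType (extScalars K X).hom :=
    inferInstanceAs (LocallyOfFiniteType (pullback.snd _ _))
  rw [← f.2, ← f.2, ← f.2, ← f.2, map_ranPoint, map_ranPoint, map_ranPoint, map_ranPoint]
  obtain ⟨B, hB⟩ := FinSubset.map_surjective (restrictPoint_surjective (X := X))
    (FinSubset.map (fun y ↦ h.hom ≫ y) (A.map fun y ↦ e.hom ≫ y))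
  obtain ⟨B', hB'⟩ := FinSubset.map_surjective (restrictPoint_surjective (X := X))
    (FinSubset.map (fun y ↦ h.hom ≫ y) (A'.map fun y ↦ e.hom ≫ y))
  rw [← hB, ← hB']
  exact value_eq_of_isAlgClosed (baseChange f) _ (F.map h.op (F.map e.op s)) B B'

end BaseChange

/-! ### Descent of functions along the projection from `F × Ran(X)` -/

section Descent

open scoped TensorProduct
open Algebra.TensorProduct (includeLeft includeRight)

variable {k : Type u} [Field k]

/-- Descent of elements along `R → R ⊗ B` for a nonzero algebra `B` over a field. -/
lemma exists_tmul_one_eq {R B : Type u} [CommRing R] [Algebra k R] [CommRing B] [Algebra k B]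
    [Nontrivial B] (v : R ⊗[k] B)
    (h : Algebra.TensorProduct.map (AlgHom.id k R) (includeLeft : B →ₐ[k] B ⊗[k] B) v =
      Algebra.TensorProduct.map (AlgHom.id k R) (includeRight : B →ₐ[k] B ⊗[k] B) v) :
    ∃ r : R, r ⊗ₜ 1 = v := by
  -- Contract the first copy of `B` with a functional that maps `1` to `1`.
  obtain ⟨l, hl⟩ := LinearMap.exists_leftInverse_of_injective (Algebra.linearMap k B)
    (LinearMap.ker_eq_bot.mpr (algebraMap k B).injective)
  have hl1 : l 1 = 1 := by simpa using LinearMap.congr_fun hl 1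
  let Φ : R ⊗[k] (B ⊗[k] B) →ₗ[k] R ⊗[k] B :=
    LinearMap.lTensor R ((TensorProduct.lid k B).toLinearMap ∘ₗ LinearMap.rTensor B l)
  let ρ : R ⊗[k] B →ₗ[k] R := (TensorProduct.rid k R).toLinearMap ∘ₗ LinearMap.lTensor R l
  have h₁ : ∀ v, Φ (Algebra.TensorProduct.map (AlgHom.id k R)
      (includeLeft : B →ₐ[k] B ⊗[k] B) v) = ρ v ⊗ₜ 1 := by
    intro v
    induction v with
    | zero => simp
    | add x y hx hy => rw [map_add, map_add, hx, hy, map_add, TensorProduct.add_tmul]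
    | tmul r b => simp [Φ, ρ, TensorProduct.smul_tmul]
  have h₂ : ∀ v, Φ (Algebra.TensorProduct.map (AlgHom.id k R)
      (includeRight : B →ₐ[k] B ⊗[k] B) v) = v := by
    intro v
    induction v with
    | zero => simp
    | add x y hx hy => rw [map_add, map_add, hx, hy]
    | tmul r b => simp [Φ, hl1]
  exact ⟨ρ v, by rw [← h₁, h, h₂]⟩

lemma exists_specMap_eq {R R' : Type u} [CommRing R] [Algebra k R] [CommRing R'] [Algebra k R']
    (g : spec k R' ⟶ spec k R) : ∃ φ : R →ₐ[k] R', g = specMap φ := by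
  have : IsOpenImmersion (Over.Hom.left (𝟙 (spec k R).obj)) :=
    inferInstanceAs (IsOpenImmersion (𝟙 (spec k R).obj.left))
  obtain ⟨φ, hφ⟩ := exists_chartPoint_eq (𝟙 (spec k R).obj) g.hom
    (by rintro t -; exact ⟨t, rfl⟩)
  refine ⟨φ, ObjectProperty.hom_ext _ ?_⟩
  rw [hφ, chartPoint, Category.comp_id]

/-- A nonempty `k`-scheme has a point over some nonzero `k`-algebra. -/
lemma exists_spec_hom {X : Over (Spec (.of k))} (x : X.left) :
    ∃ (B : Type u) (_ : CommRing B) (_ : Algebra k B) (_ : Nontrivial B),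
      Nonempty ((spec k B).obj ⟶ X) := by
  let φ := Spec.preimage (R := .of k) (X.left.fromSpecResidueField x ≫ X.hom)
  let : Algebra k (X.left.residueField x) := φ.hom.toAlgebra
  exact ⟨X.left.residueField x, inferInstance, inferInstance, inferInstance,
    ⟨Over.homMk (X.left.fromSpecResidueField x) (Spec.map_preimage _).symm⟩⟩

variable {X : Over (Spec (.of k))} {F : Prestack k} (f : functions (prod F (Ran X)))

/-- The function `b` on `T` is the common value of `f` over the point `s ∈ F(T)`. -/
def IsCommonValue (T : AffSch k) (s : F.obj (op T)) (b : Γ(T.obj.left, ⊤)) : Prop :=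
  ∀ (T' : AffSch k) (g : T' ⟶ T) (A : FinSubset (T'.obj ⟶ X)),
    g.hom.left.appTop b = f.1 T' (ranPoint (F.map g.op s) A)

lemma IsCommonValue.map {T T' : AffSch k} {s : F.obj (op T)} {b : Γ(T.obj.left, ⊤)}
    (h : IsCommonValue f T s b) (g : T' ⟶ T) :
    IsCommonValue f T' (F.map g.op s) (g.hom.left.appTop b) := by
  intro T'' g' A
  have := h T'' (g' ≫ g) A
  rw [op_comp, Functor.map_comp] at this
  refine Eq.trans ?_ this
  exact (ConcreteCategory.congr_hom (Scheme.Hom.comp_appTop g'.hom.left g.hom.left) b).symm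

/-- Common values are unique, since `Γ(T, 𝒪) → Γ(T ×ₖ Spec B, 𝒪)` is injective for `B ≠ 0` and `X` has
a point over `T ×ₖ Spec B` for some such `B`. -/
lemma eq_of_isCommonValue [Nonempty X.left] {T : AffSch k} {s : F.obj (op T)}
    {b b' : Γ(T.obj.left, ⊤)} (h : IsCommonValue f T s b) (h' : IsCommonValue f T s b') :
    b = b' := by
  obtain ⟨R, _, _, e, he⟩ := exists_spec_iso T
  have : IsIso e.hom.left.appTop := inferInstanceAs (IsIso (e.hom.left.app ⊤))
  apply (ConcreteCategory.bijective_of_isIso e.hom.left.appTop).1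
  obtain ⟨B, _, _, _, ⟨y⟩⟩ := exists_spec_hom (Classical.arbitrary X.left)
  have hinj : Function.Injective
      (specMap (includeLeft : R →ₐ[k] R ⊗[k] B)).hom.left.appTop :=
    appTop_injective_of_injective _
      (Algebra.TensorProduct.includeLeft_injective (S := k) (algebraMap k B).injective)
  apply hinj
  let A : FinSubset ((spec k (R ⊗[k] B)).obj ⟶ X) :=
    .single ((specMap (includeRight : B →ₐ[k] R ⊗[k] B)).hom ≫ y)
  exact (h.map f e _ _ A).trans (h'.map f e _ _ A).symm

variable [LocallyOfFiniteType X.hom] [GeometricallyConnected X.hom]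

/-- After adjoining a point of `X` over `B ≠ 0`, the value of `f` lies in `R ⊗ B`; it descends to `R`
since `f` takes the same value at the two resulting points over `R ⊗ (B ⊗ B)`. -/
lemma exists_isCommonValue_spec [Nonempty X.left] (R : Type u) [CommRing R] [Algebra k R]
    (s : F.obj (op (spec k R))) : ∃ b, IsCommonValue f (spec k R) s b := by
  obtain ⟨B, _, _, _, ⟨y⟩⟩ := exists_spec_hom (Classical.arbitrary X.left)
  -- The value of `f` over `R'` after adjoining the point `y`.
  let v (R' : Type u) [CommRing R'] [Algebra k R'] (s' : F.obj (op (spec k R'))) : R' ⊗[k] B :=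
    value f (ranPoint (F.map (specMap (includeLeft : R' →ₐ[k] R' ⊗[k] B)).op s')
      (.single ((specMap (includeRight : B →ₐ[k] R' ⊗[k] B)).hom ≫ y)))
  have value_congr : ∀ {R' : Type u} [CommRing R'] [Algebra k R'] (s' : F.obj (op (spec k R')))
      (A A' : FinSubset ((spec k R').obj ⟶ X)),
      value f (ranPoint s' A) = value f (ranPoint s' A') := fun {R'} _ _ s' A A' ↦
    congrArg (fun c ↦ (Scheme.ΓSpecIso (.of R')).hom c) (value_eq f _ s' A A')
  have map_value : ∀ {R' R'' : Type u} [CommRing R'] [Algebra k R'] [CommRing R''] [Algebra k R'']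
      (φ : R' →ₐ[k] R'') (s' : F.obj (op (spec k R'))) (A : FinSubset ((spec k R').obj ⟶ X)),
      φ (value f (ranPoint s' A)) =
        value f (ranPoint (F.map (specMap φ).op s') (A.map fun y ↦ (specMap φ).hom ≫ y)) :=
    fun φ s' A ↦ (value_map f φ _).symm
  have map_map : ∀ {R₁ R₂ R₃ : Type u} [CommRing R₁] [Algebra k R₁] [CommRing R₂] [Algebra k R₂]
      [CommRing R₃] [Algebra k R₃] (ψ : R₂ →ₐ[k] R₃) (φ : R₁ →ₐ[k] R₂)
      (s' : F.obj (op (spec k R₁))),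
      F.map (specMap ψ).op (F.map (specMap φ).op s') = F.map (specMap (ψ.comp φ)).op s' := by
    intro R₁ R₂ R₃ _ _ _ _ _ _ ψ φ s'
    rw [specMap_comp, op_comp, Functor.map_comp]
    rfl
  obtain ⟨b, hb⟩ := exists_tmul_one_eq (v R s) (by
    rw [map_value, map_value, map_map, map_map,
      Algebra.TensorProduct.map_comp_includeLeft, Algebra.TensorProduct.map_comp_includeLeft]
    exact value_congr _ _ _)
  refine ⟨(Scheme.ΓSpecIso (.of R)).inv b, fun T' g A ↦ ?_⟩
  obtain ⟨R', _, _, e, he⟩ := exists_spec_iso T'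
  have : IsIso e.hom.left.appTop := inferInstanceAs (IsIso (e.hom.left.app ⊤))
  apply (ConcreteCategory.bijective_of_isIso e.hom.left.appTop).1
  rw [← f.2, map_ranPoint]
  obtain ⟨φ, hφ⟩ := exists_specMap_eq (e ≫ g)
  have hs : F.map e.op (F.map g.op s) = F.map (specMap φ).op s := by
    rw [← hφ, op_comp, Functor.map_comp]
    rfl
  have hΓ : e.hom.left.appTop (g.hom.left.appTop ((Scheme.ΓSpecIso (.of R)).inv b)) =
      (Scheme.ΓSpecIso (.of R')).inv (φ b) := by
    have h₁ := ConcreteCategory.congr_hom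
      (Scheme.ΓSpecIso_inv_naturality (CommRingCat.ofHom φ.toRingHom)) b
    have h₂ : (e ≫ g).hom.left.appTop = g.hom.left.appTop ≫ e.hom.left.appTop :=
      Scheme.Hom.comp_appTop e.hom.left g.hom.left
    rw [hφ] at h₂
    exact (ConcreteCategory.congr_hom h₂ _).symm.trans h₁.symm
  rw [hΓ, hs]
  apply (ConcreteCategory.bijective_of_isIso (Scheme.ΓSpecIso (.of R')).hom).1
  refine (ConcreteCategory.congr_hom (Scheme.ΓSpecIso (.of R')).inv_hom_id (φ b)).trans ?_
  change φ b = value f _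
  apply Algebra.TensorProduct.includeLeft_injective (R := k) (A := R') (S := k) (B := B)
    (algebraMap k B).injective
  have hφb : (includeLeft : R' →ₐ[k] R' ⊗[k] B) (φ b) =
      Algebra.TensorProduct.map φ (AlgHom.id k B) (b ⊗ₜ 1) := by simp
  refine hφb.trans ?_
  rw [hb]
  refine (map_value _ _ _).trans (Eq.trans ?_ (map_value _ _ _).symm)
  rw [map_map, map_map, Algebra.TensorProduct.map_comp_includeLeft]
  exact value_congr _ _ _

lemma exists_isCommonValue [Nonempty X.left] (T : AffSch k) (s : F.obj (op T)) :
    ∃ b, IsCommonValue f T s b := by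
  obtain ⟨R, _, _, e, he⟩ := exists_spec_iso T
  have : IsIso e.hom.left.appTop := inferInstanceAs (IsIso (e.hom.left.app ⊤))
  obtain ⟨b', hb'⟩ := exists_isCommonValue_spec f R (F.map e.op s)
  obtain ⟨b, rfl⟩ := (ConcreteCategory.bijective_of_isIso e.hom.left.appTop).2 b'
  let i : T ⟶ spec k R := ObjectProperty.homMk (Over.homMk (inv e.hom.left) (by
    rw [IsIso.inv_comp_eq]
    exact (Over.w e.hom).symm))
  have hi : i ≫ e = 𝟙 T := by
    apply ObjectProperty.hom_ext
    apply Over.OverMorphism.ext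
    exact IsIso.inv_hom_id e.hom.left
  have := hb'.map f i
  refine ⟨b, ?_⟩
  have h₁ : F.map i.op (F.map e.op s) = s := by
    have : F.map (i ≫ e).op s = s := by rw [hi, op_id, CategoryTheory.Functor.map_id]; rfl
    rwa [op_comp, Functor.map_comp] at this
  have h₂ : i.hom.left.appTop (e.hom.left.appTop b) = b := by
    have h := (Scheme.Hom.comp_appTop i.hom.left e.hom.left).symm
    rw [show i.hom.left ≫ e.hom.left = 𝟙 _ from IsIso.inv_hom_id e.hom.left,
      Scheme.Hom.id_appTop] at h
    exact ConcreteCategory.congr_hom h b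
  rwa [h₁, h₂] at this

variable (F X) in
/-- The projection `F × Ran(X) → F`. -/
def fstRan : prod F (Ran X) ⟶ F where
  app T := ↾fun x ↦ x.1

/-- `Γ(F, 𝒪) → Γ(F × Ran(X), 𝒪)` is bijective for every prestack `F`. -/
lemma comap_fstRan_bijective [Nonempty X.left] :
    Function.Bijective (functions.comap (fstRan X F)) := by
  refine ⟨fun a a' h ↦ ?_, fun f ↦ ?_⟩
  · have hval : ∀ (a : functions F) T s,
        IsCommonValue (functions.comap (fstRan X F) a) T s (a.1 T s) :=
      fun a T s T' g A ↦ (a.2 T T' g s).symm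
    refine Subtype.ext (funext fun T ↦ funext fun s ↦ ?_)
    exact eq_of_isCommonValue _ (hval a T s) (h ▸ hval a' T s)
  · choose b hb using exists_isCommonValue f
    refine ⟨⟨b, fun T T' g s ↦ eq_of_isCommonValue f (hb T' _) ((hb T s).map f g)⟩, ?_⟩
    refine Subtype.ext (funext fun T ↦ funext fun x ↦ ?_)
    have := hb T x.1 T (𝟙 T) x.2
    rw [op_id, CategoryTheory.Functor.map_id] at this
    exact (ConcreteCategory.congr_hom (Scheme.Hom.id_appTop (X := T.obj.left)) _).symm.trans this

end Descent

/-! ### Functions on a scheme and on its prestack of points -/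

section Points

variable {k : Type u} [Field k]

lemma topIso_appTop_ι {S : Scheme.{u}} (V : S.Opens) (b : Γ(S, ⊤)) :
    V.topIso.hom (V.ι.appTop b) = S.presheaf.map (homOfLE le_top).op b := by
  have : V.ι.appTop ≫ V.topIso.hom = S.presheaf.map (homOfLE le_top).op := by
    rw [Scheme.Opens.ι_appTop, Scheme.Opens.topIso_hom]
    erw [← S.presheaf.map_comp]
    rfl
  exact ConcreteCategory.congr_hom this b

/-- Compatible functions on the affine open subschemes of a scheme glue. -/
lemma exists_appTop_ι_eq (S : Scheme.{u}) (a : ∀ V : S.affineOpens, Γ(V.1, ⊤))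
    (h : ∀ (V W : S.affineOpens) (e : W.1 ≤ V.1), a W = (S.homOfLE e).appTop (a V)) :
    ∃ b : Γ(S, ⊤), ∀ V : S.affineOpens, V.1.ι.appTop b = a V := by
  let sf : ∀ V : S.affineOpens, Γ(S, V.1) := fun V ↦ V.1.topIso.hom (a V)
  have hres : ∀ (V W : S.affineOpens) (e : W.1 ≤ V.1),
      S.presheaf.map (homOfLE e).op (sf V) = sf W := by
    intro V W e
    have : V.1.topIso.hom ≫ S.presheaf.map (homOfLE e).op =
        (S.homOfLE e).appTop ≫ W.1.topIso.hom := by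
      rw [Scheme.homOfLE_appTop, Scheme.Opens.topIso_hom, Scheme.Opens.topIso_hom]
      erw [← S.presheaf.map_comp, ← S.presheaf.map_comp]
      rfl
    have := ConcreteCategory.congr_hom this (a V)
    exact this.trans (congrArg _ (h V W e).symm)
  have hmap : ∀ {V U W : S.Opens} (i : U ⟶ V) (j : W ⟶ U) (c : Γ(S, V)),
      S.presheaf.map j.op (S.presheaf.map i.op c) =
        S.presheaf.map (homOfLE (j.le.trans i.le)).op c := fun i j c ↦
    (ConcreteCategory.congr_hom (S.presheaf.map_comp i.op j.op) c).symm
  obtain ⟨b, hb, -⟩ := TopCat.Sheaf.existsUnique_gluing' S.sheaf (fun V : S.affineOpens ↦ V.1) ⊤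
    (fun V ↦ homOfLE le_top) (fun x _ ↦ by
      obtain ⟨W, hxW, -⟩ := exists_affineOpens_le ⊤ x trivial
      exact TopologicalSpace.Opens.mem_iSup.mpr ⟨W, hxW⟩) sf (by
      intro V V'
      refine S.IsSheaf.section_ext fun x hx ↦ ?_
      obtain ⟨W, hxW, hWV⟩ := exists_affineOpens_le _ x hx
      exact ⟨W, hWV, hxW, ((hmap _ _ _).trans (hres V W _)).trans
        ((hmap _ _ _).trans (hres V' W _)).symm⟩)
  refine ⟨b, fun V ↦ ?_⟩
  apply (ConcreteCategory.bijective_of_isIso V.1.topIso.hom).1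
  exact (topIso_appTop_ι V.1 b).trans (hb V)

/-- The pullback of functions on a `k`-scheme to the prestack of its points. -/
def evalPoints (S : Over (Spec (.of k))) : Γ(S.left, ⊤) →+* functions (points S) where
  toFun b := ⟨fun _ x ↦ Over.Hom.left x |>.appTop b, fun T T' f x ↦ by
    change (f.hom.left ≫ x.left).appTop b = _
    rw [Scheme.Hom.comp_appTop]
    rfl⟩
  map_one' := by ext; simp
  map_mul' _ _ := by ext; simp
  map_zero' := by ext; simp
  map_add' _ _ := by ext; simp

/-- A function on the prestack of points of `S` is the same as a function on `S`. -/
lemma evalPoints_bijective (S : Over (Spec (.of k))) : Function.Bijective (evalPoints S) := by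
  refine ⟨fun b b' h ↦ ?_, fun a ↦ ?_⟩
  · refine S.left.IsSheaf.section_ext fun x hx ↦ ?_
    obtain ⟨V, hxV, -⟩ := exists_affineOpens_le ⊤ x hx
    refine ⟨V, le_top, hxV, ?_⟩
    rw [← topIso_appTop_ι, ← topIso_appTop_ι]
    exact congrArg _ congr($(h).1 (affineOpen S V) (affineOpenι S V))
  · obtain ⟨b, hb⟩ := exists_appTop_ι_eq S.left
      (fun V ↦ a.1 (affineOpen S V) (affineOpenι S V)) (by
        intro V W e
        let i : affineOpen S W ⟶ affineOpen S V := ObjectProperty.homMk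
          (Over.homMk (S.left.homOfLE e) (by
            change S.left.homOfLE e ≫ V.1.ι ≫ S.hom = W.1.ι ≫ S.hom
            rw [← Category.assoc, Scheme.homOfLE_ι]))
        refine Eq.trans ?_ (a.2 _ _ i (affineOpenι S V))
        exact congrArg (a.1 (affineOpen S W))
          (Over.OverMorphism.ext (Scheme.homOfLE_ι _ e).symm :
            affineOpenι S W = i.hom ≫ affineOpenι S V))
    refine ⟨b, Subtype.ext (funext fun T ↦ funext fun s ↦ ?_)⟩
    refine eq_of_forall_exists_openImmersion T _ _ fun t ↦ ?_
    obtain ⟨V, hV, -⟩ := exists_affineOpens_le ⊤ (s.left t) trivial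
    obtain ⟨W, hW, hWV⟩ := exists_affineOpens_le (s.left ⁻¹ᵁ V.1) t hV
    let j : affineOpen T.obj W ⟶ T := ObjectProperty.homMk (affineOpenι T.obj W)
    refine ⟨_, j, inferInstanceAs (IsOpenImmersion W.1.ι), ⟨⟨t, hW⟩, rfl⟩, ?_⟩
    -- On `W` the point `s` factors through the affine open subset `V`.
    have hr : Set.range (W.1.ι ≫ s.left) ⊆ Set.range V.1.ι := by
      rintro _ ⟨w, rfl⟩
      exact ⟨⟨s.left w.1, hWV w.2⟩, rfl⟩
    let l := IsOpenImmersion.lift V.1.ι (W.1.ι ≫ s.left) hr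
    have hl : l ≫ V.1.ι = W.1.ι ≫ s.left := IsOpenImmersion.lift_fac _ _ _
    let i : affineOpen T.obj W ⟶ affineOpen S V := ObjectProperty.homMk (Over.homMk l (by
      change l ≫ V.1.ι ≫ S.hom = W.1.ι ≫ T.obj.hom
      rw [← Category.assoc, hl, Category.assoc, Over.w s]))
    have hi : (points S).map j.op s = (points S).map i.op (affineOpenι S V) :=
      Over.OverMorphism.ext hl.symm
    have h₁ := (evalPoints S b).2 _ _ j s
    have h₂ := a.2 _ _ j s
    have h₃ := (evalPoints S b).2 _ _ i (affineOpenι S V)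
    have h₄ := a.2 _ _ i (affineOpenι S V)
    exact h₁.symm.trans ((congrArg _ hi).trans ((h₃.trans ((congrArg _ (hb V)).trans h₄.symm)).trans
      ((congrArg _ hi.symm).trans h₂)))

end Points

end

end RanSpace

theorem lemma5 {k : Type u} [Field k] {X S : Scheme.{u}}
    (p : X ⟶ Spec (.of k)) [Smooth p] [GeometricallyConnected p]
    (q : S ⟶ Spec (.of k)) [IsLocallyNoetherian S] :
    Function.Bijective (RanSpace.pullback (Over.mk q) (RanSpace.Ran (Over.mk p))) := by
  have : Surjective p := inferInstance
  have hne : Nonempty (Over.mk p).left :=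
    ⟨(p.surjective (⊥ : PrimeSpectrum k)).choose⟩
  have hft : LocallyOfFiniteType (Over.mk p).hom := inferInstanceAs (LocallyOfFiniteType p)
  have hgc : GeometricallyConnected (Over.mk p).hom := ‹GeometricallyConnected p›
  exact (RanSpace.comap_fstRan_bijective (X := Over.mk p)
    (F := RanSpace.points (Over.mk q))).comp (RanSpace.evalPoints_bijective (Over.mk q))
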